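/- Let $A \in M_m(\mathbb{C})$, and let $\{a_1, \ldots, a_k\}$ be the set of moduli of the eigenvalues of $A$, indexed so that $0 \le a_1 < a_2 < \cdots < a_k$. Let $A = D + N$ be the Jordan–Chevalley decomposition of $A$, so that $D$ is diagonalizable, $N$ is nilpotent and $DN = ND$. For $1 \le j \le k$ let $E_j$ be the orthogonal projection of $\mathbb{C}^m$ onto the subspace spanned by the eigenvectors of $D$ whose eigenvalue has modulus at most $a_j$, and set $E_0 := 0$. For a matrix $T$ write $|T| := \sqrt{T^*T}$, let $\mathrm{ran}(T)$ be its range in $\mathbb{C}^m$, and let $\|\cdot\|$ be the Euclidean norm. Then: (i) The matrix $\sum_{j=1}^k a_j (E_j - E_{j-1})$ is positive-semidefinite, and $|A^n|^{1/n}$ converges to it as $n \to \infty$. (ii) For every $1 \le j \le k$, a non-zero vector $x \in \mathbb{C}^m$ lies in $\mathrm{ran}(E_j) \setminus \mathrm{ran}(E_{j-1})$ if and only if $\lim_{n \to \infty} \|A^n x\|^{1/n}$ exists and equals $a_j$. (iii) For every $1 \le j \le k$ with $a_j \neq 0$, the set $\mathrm{ran}(E_j) \setminus \mathrm{ran}(E_{j-1})$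 is invariant under $A^p$ for every $p \in \mathbb{N}$. For every $1 \le j \le k$ (including the case $j = 1$, $a_1 = 0$), every $p \in \mathbb{N}$ and every $x \in \mathrm{ran}(E_j) \setminus \mathrm{ran}(E_{j-1})$, if $A^p x \ne 0$ then $A^p x \in \mathrm{ran}(E_j) \setminus \mathrm{ran}(E_{j-1})$. -/

import Mathlib

open Filter Topology
open scoped ComplexOrder MatrixOrder

/-- `A = D + N` is the Jordan–Chevalley decomposition of `A`: the summands commute, `D` is
diagonalizable (its eigenvectors span `ℂ^m`) and `N` is nilpotent. -/
structure IsJordanChevalley {m : ℕ} (A D N : Matrix (Fin m) (Fin m) ℂ) : Prop where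
  add_eq : A = D + N
  commute : Commute D N
  diagonalizable : ⨆ μ : ℂ, Module.End.eigenspace (Matrix.toEuclideanLin D) μ = ⊤
  nilpotent : IsNilpotent N

/-- The set of moduli `|μ|` of the eigenvalues `μ` of `A`. -/
def eigenvalueModuli {m : ℕ} (A : Matrix (Fin m) (Fin m) ℂ) : Set ℝ :=
  {r | ∃ μ : ℂ, Module.End.HasEigenvalue (Matrix.toEuclideanLin A) μ ∧ ‖μ‖ = r}

/-- The subspace of `ℂ^m` spanned by the eigenvectors of `D` whose eigenvalue has modulus at
most `r`. -/
def eigenvectorSpan {m : ℕ} (D : Matrix (Fin m) (Fin m) ℂ) (r : ℝ) :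
    Submodule ℂ (EuclideanSpace ℂ (Fin m)) :=
  Submodule.span ℂ
    {x | ∃ μ : ℂ, ‖μ‖ ≤ r ∧ Module.End.HasEigenvector (Matrix.toEuclideanLin D) μ x}

/-- The matrix of the orthogonal projection of `ℂ^m` onto the subspace `U`. -/
noncomputable def orthProjMatrix {m : ℕ} (U : Submodule ℂ (EuclideanSpace ℂ (Fin m))) :
    Matrix (Fin m) (Fin m) ℂ :=
  (Matrix.toEuclideanCLM (n := Fin m) (𝕜 := ℂ)).symm U.starProjection

/-- The matrices `E_0, E_1, …, E_k`: `E_0 = 0`, and for `1 ≤ j ≤ k` the matrix `E_j` is the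
orthogonal projection onto the span of the eigenvectors of `D` with eigenvalue-modulus at most
`a_j`. The numbers `a_1, …, a_k` are indexed by `Fin k`, so that for `j : Fin k` the matrix
`E j.succ` belongs to `a j`, and `E j.castSucc` is its predecessor. -/
noncomputable def modulusProj {m k : ℕ} (D : Matrix (Fin m) (Fin m) ℂ) (a : Fin k → ℝ) :
    Fin (k + 1) → Matrix (Fin m) (Fin m) ℂ :=
  Fin.cons 0 fun j => orthProjMatrix (eigenvectorSpan D (a j))

/-- The range of a matrix as a subspace of `ℂ^m`. -/
noncomputable def matrixRan {m : ℕ} (T : Matrix (Fin m) (Fin m) ℂ) :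
    Submodule ℂ (EuclideanSpace ℂ (Fin m)) :=
  LinearMap.range (Matrix.toEuclideanLin T)

/-- The set `ran(E_j) \ ran(E_{j-1})`. -/
def ranDiff {m k : ℕ} (D : Matrix (Fin m) (Fin m) ℂ) (a : Fin k → ℝ) (j : Fin k) :
    Set (EuclideanSpace ℂ (Fin m)) :=
  (matrixRan (modulusProj D a j.succ) : Set (EuclideanSpace ℂ (Fin m))) \
    (matrixRan (modulusProj D a j.castSucc) : Set (EuclideanSpace ℂ (Fin m)))

/-- `|T|^{1/n}`, where `|T| = √(Tᴴ T)` is the absolute value of the matrix `T`; the root is the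
positive-semidefinite one. -/
noncomputable def absRoot {m : ℕ} (T : Matrix (Fin m) (Fin m) ℂ) (n : ℕ) :
    Matrix (Fin m) (Fin m) ℂ :=
  CFC.abs T ^ (1 / (n : ℝ))

/-! On a subspace invariant under `A`, the norms of the powers `A ^ n` are squeezed between
exponentials with rates arbitrarily close to the extreme moduli of the eigenvalues there; polynomial
factors from Jordan blocks are absorbed by the slack in the rate. Since `D` commutes with `A` and `A
- D` is nilpotent, sums of eigenspaces of `D` are such subspaces with known spectrum. They form a
flag on whose `j`-th layer `A` grows at rate `a j`. The structure `IsGrowthFlag` records this; (ii)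
and (iii) follow from it directly.

For (i), let `e n` be a unit eigenvector of `|A^n|^{1/n}` with eigenvalue `s n`. Then `s n ^ n =
‖A^n (e n)‖`, and `s n ^ n * |⟨e n, v⟩| ≤ ‖A^n v‖` for all `v`. Along an ultrafilter, `e n → e₀` and
`s n → s₀`. The equality bounds `s₀` below by the rate of the layer of `e₀`; the inequality, with
`v` a projection of `e₀`, bounds it above (`le_limit`, `limit_le`). Together they force `e₀` to be
an eigenvector of the claimed limit with eigenvalue `s₀` (`flagOperator_limit`). Passing to the
limit in the spectral expansions then gives convergence (`tendsto_sum_eigenvectors`). -/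

namespace Module.End

theorem hasEigenvalue_of_mem_maxGenEigenspace {K V : Type*} [Field K] [AddCommGroup V]
    [Module K V] {f : End K V} {μ : K} {x : V} (hx : x ∈ f.maxGenEigenspace μ) (hx0 : x ≠ 0) :
    f.HasEigenvalue μ := by
  obtain ⟨k, hk⟩ := (mem_maxGenEigenspace f μ x).1 hx
  refine hasEigenvalue_of_hasGenEigenvalue (k := k) ?_
  rw [HasGenEigenvalue, HasUnifEigenvalue, Submodule.ne_bot_iff]
  exact ⟨x, mem_genEigenspace_nat.2 (by simpa using hk), hx0⟩

/-! ### Exponential bounds for powers of an operator -/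

section Growth

variable {F : Type*} [NormedAddCommGroup F] [NormedSpace ℂ F]

theorem exists_norm_pow_apply_le_of_mem_maxGenEigenspace (g : End ℂ F) {c : ℂ} {ρ : ℝ}
    (hc : ‖c‖ < ρ) {x : F} (hx : x ∈ g.maxGenEigenspace c) :
    ∃ C, ∀ n : ℕ, ‖(g ^ n) x‖ ≤ C * ρ ^ n := by
  obtain ⟨k, hk⟩ := (mem_maxGenEigenspace g c x).1 hx
  clear hx
  have hρ : 0 < ρ := (norm_nonneg c).trans_lt hc
  induction k generalizing x with
  | zero =>
    refine ⟨0, fun n => ?_⟩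
    have : x = 0 := by simpa using hk
    simp [this]
  | succ k ih =>
    obtain ⟨C, hC⟩ := ih (x := (g - c • 1) x) (by rw [← Module.End.mul_apply, ← pow_succ, hk])
    -- `‖x‖` covers `n = 0`; the second entry gives `‖c‖ * B + C ≤ B * ρ`, which closes the
    -- recursion.
    refine ⟨max ‖x‖ (C / (ρ - ‖c‖)), fun n => ?_⟩
    set B := max ‖x‖ (C / (ρ - ‖c‖)) with hB
    induction n with
    | zero => simp [hB]
    | succ n ihn =>
      have h1 : (g ^ (n + 1)) x = c • (g ^ n) x + (g ^ n) ((g - c • 1) x) := by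
        simp [pow_succ, Module.End.mul_apply]
      have h2 : C ≤ B * (ρ - ‖c‖) := by
        rw [← div_le_iff₀ (sub_pos.2 hc)]
        exact le_max_right _ _
      have hρn : 0 < ρ ^ n := pow_pos hρ n
      calc ‖(g ^ (n + 1)) x‖ ≤ ‖c‖ * ‖(g ^ n) x‖ + ‖(g ^ n) ((g - c • 1) x)‖ := by
            rw [h1, ← norm_smul]; exact norm_add_le _ _
        _ ≤ ‖c‖ * (B * ρ ^ n) + (B * (ρ - ‖c‖)) * ρ ^ n := by
            refine add_le_add (mul_le_mul_of_nonneg_left ihn (norm_nonneg c)) ((hC n).trans ?_)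
            exact mul_le_mul_of_nonneg_right h2 hρn.le
        _ = B * ρ ^ (n + 1) := by ring

/-- Generalized eigenspaces span, so each vector has its own constant; Banach–Steinhaus for `ρ⁻ⁿ gⁿ`
makes it uniform. Uniformity matters because the bound is later applied to vectors depending on `n`.
-/
theorem exists_norm_pow_apply_le [FiniteDimensional ℂ F] (g : End ℂ F) {ρ : ℝ} (hρ : 0 < ρ)
    (h : ∀ c, g.HasEigenvalue c → ‖c‖ < ρ) :
    ∃ C, 0 < C ∧ ∀ (n : ℕ) (x : F), ‖(g ^ n) x‖ ≤ C * ρ ^ n * ‖x‖ := by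
  have hpt : ∀ x : F, ∃ C, ∀ n : ℕ, ‖(g ^ n) x‖ ≤ C * ρ ^ n := by
    intro x
    have hx : x ∈ ⨆ μ, g.maxGenEigenspace μ := by
      rw [iSup_maxGenEigenspace_eq_top]; trivial
    induction hx using Submodule.iSup_induction' with
    | mem c x hx =>
      by_cases hx0 : x = 0
      · exact ⟨0, fun n => by simp [hx0]⟩
      exact exists_norm_pow_apply_le_of_mem_maxGenEigenspace g
        (h c (hasEigenvalue_of_mem_maxGenEigenspace hx hx0)) hx
    | zero => exact ⟨0, fun n => by simp⟩
    | add x y _ _ hx hy =>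
      obtain ⟨C, hC⟩ := hx
      obtain ⟨C', hC'⟩ := hy
      refine ⟨C + C', fun n => ?_⟩
      rw [map_add, add_mul]
      exact (norm_add_le _ _).trans (add_le_add (hC n) (hC' n))
  have : CompleteSpace F := FiniteDimensional.complete ℂ F
  obtain ⟨C, hC⟩ := banach_steinhaus
    (g := fun n : ℕ => ((ρ : ℂ) ^ n)⁻¹ • LinearMap.toContinuousLinearMap (g ^ n)) (by
      intro x
      obtain ⟨C, hC⟩ := hpt x
      refine ⟨C, fun n => ?_⟩
      have := hC n
      simp only [_root_.smul_apply, LinearMap.coe_toContinuousLinearMap', norm_smul,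
        norm_inv, norm_pow, Complex.norm_real, Real.norm_of_nonneg hρ.le]
      rwa [inv_mul_le_iff₀ (pow_pos hρ n), mul_comm])
  refine ⟨max C 1, by positivity, fun n x => ?_⟩
  have h1 := ContinuousLinearMap.le_of_opNorm_le _ ((hC n).trans (le_max_left C 1)) x
  simp only [_root_.smul_apply, LinearMap.coe_toContinuousLinearMap', norm_smul,
    norm_inv, norm_pow, Complex.norm_real, Real.norm_of_nonneg hρ.le] at h1
  rw [inv_mul_le_iff₀ (pow_pos hρ n)] at h1
  linarith

/-- All eigenvalues are nonzero, so `g` is invertible, and the upper bound applies to its inverse,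
with rate `ρ⁻¹`. -/
theorem exists_le_norm_pow_apply [FiniteDimensional ℂ F] (g : End ℂ F) {ρ : ℝ} (hρ : 0 < ρ)
    (h : ∀ c, g.HasEigenvalue c → ρ < ‖c‖) :
    ∃ C, 0 < C ∧ ∀ (n : ℕ) (x : F), C * ρ ^ n * ‖x‖ ≤ ‖(g ^ n) x‖ := by
  have hinj : Function.Injective g := by
    rw [← LinearMap.ker_eq_bot]
    by_contra hk
    have : g.HasEigenvalue 0 := by
      rwa [HasEigenvalue, HasUnifEigenvalue, ← eigenspace, eigenspace_zero]
    simpa using hρ.trans (h 0 this)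
  let e := LinearEquiv.ofInjectiveEndo g hinj
  have heg : ∀ y, e.symm (g y) = y := fun y => e.symm_apply_apply y
  have hge : ∀ y, g (e.symm y) = y := fun y => e.apply_symm_apply y
  obtain ⟨C, hC, hb⟩ := exists_norm_pow_apply_le (e.symm : End ℂ F) (inv_pos.2 hρ) (by
    intro c hc
    obtain ⟨y, hy⟩ := hc.exists_hasEigenvector
    have hy1 : e.symm y = c • y := hy.apply_eq_smul
    have hy2 : y = c • g y := by rw [← map_smul, ← hy1, hge]
    have hc0 : c ≠ 0 := by
      rintro rfl
      exact hy.2 (by rw [hy2, zero_smul])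
    have hev : g.HasEigenvector c⁻¹ y :=
      ⟨mem_eigenspace_iff.2 (by rw [eq_inv_smul_iff₀ hc0, ← hy2]), hy.2⟩
    have := h _ (hasEigenvalue_of_hasEigenvector hev)
    rw [norm_inv] at this
    exact (lt_inv_comm₀ hρ (norm_pos_iff.2 hc0)).1 this)
  have hinv : ∀ (n : ℕ) (x : F), (((e.symm : End ℂ F)) ^ n) ((g ^ n) x) = x := by
    intro n
    induction n with
    | zero => simp
    | succ n ih =>
      intro x
      rw [pow_succ, pow_succ', Module.End.mul_apply, Module.End.mul_apply]
      exact (congrArg _ (heg _)).trans (ih x)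
  refine ⟨C⁻¹, inv_pos.2 hC, fun n x => ?_⟩
  have h1 := hb n ((g ^ n) x)
  rw [hinv] at h1
  have hρn : 0 < ρ ^ n := pow_pos hρ n
  rw [inv_pow] at h1
  calc C⁻¹ * ρ ^ n * ‖x‖ ≤ C⁻¹ * ρ ^ n * (C * (ρ ^ n)⁻¹ * ‖(g ^ n) x‖) := by gcongr
    _ = ‖(g ^ n) x‖ := by field_simp

theorem coe_restrict_pow_apply (f : End ℂ F) {U : Submodule ℂ F} (hU : ∀ x ∈ U, f x ∈ U)
    (n : ℕ) (x : U) : ((((f.restrict hU : End ℂ U) ^ n) x : U) : F) = (f ^ n) x := by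
  induction n generalizing x with
  | zero => rfl
  | succ n ih => rw [pow_succ, pow_succ, Module.End.mul_apply, ih]; rfl

theorem hasEigenvector_of_restrict (f : End ℂ F) {U : Submodule ℂ F} (hU : ∀ x ∈ U, f x ∈ U)
    {c : ℂ} {y : U} (hy : HasEigenvector (f.restrict hU : End ℂ U) c y) :
    f.HasEigenvector c (y : F) :=
  ⟨mem_eigenspace_iff.2 (congrArg Subtype.val hy.apply_eq_smul),
    fun h => hy.2 (Subtype.ext h)⟩

theorem exists_norm_pow_apply_le_of_invariant [FiniteDimensional ℂ F] (f : End ℂ F)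
    {U : Submodule ℂ F} (hU : ∀ x ∈ U, f x ∈ U) {ρ : ℝ} (hρ : 0 < ρ)
    (h : ∀ c, ∀ y ∈ U, f.HasEigenvector c y → ‖c‖ < ρ) :
    ∃ C, 0 < C ∧ ∀ (n : ℕ), ∀ x ∈ U, ‖(f ^ n) x‖ ≤ C * ρ ^ n * ‖x‖ := by
  obtain ⟨C, hC, hb⟩ := exists_norm_pow_apply_le (f.restrict hU : End ℂ U) hρ (by
    intro c hc
    obtain ⟨y, hy⟩ := hc.exists_hasEigenvector
    exact h c y y.2 (hasEigenvector_of_restrict f hU hy))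
  refine ⟨C, hC, fun n x hx => ?_⟩
  rw [← coe_restrict_pow_apply f hU n ⟨x, hx⟩]
  exact hb n ⟨x, hx⟩

theorem exists_le_norm_pow_apply_of_invariant [FiniteDimensional ℂ F] (f : End ℂ F)
    {U : Submodule ℂ F} (hU : ∀ x ∈ U, f x ∈ U) {ρ : ℝ} (hρ : 0 < ρ)
    (h : ∀ c, ∀ y ∈ U, f.HasEigenvector c y → ρ < ‖c‖) :
    ∃ C, 0 < C ∧ ∀ (n : ℕ), ∀ x ∈ U, C * ρ ^ n * ‖x‖ ≤ ‖(f ^ n) x‖ := by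
  obtain ⟨C, hC, hb⟩ := exists_le_norm_pow_apply (f.restrict hU : End ℂ U) hρ (by
    intro c hc
    obtain ⟨y, hy⟩ := hc.exists_hasEigenvector
    exact h c y y.2 (hasEigenvector_of_restrict f hU hy))
  refine ⟨C, hC, fun n x hx => ?_⟩
  rw [← coe_restrict_pow_apply f hU n ⟨x, hx⟩]
  exact hb n ⟨x, hx⟩

end Growth

/-! ### Sums of eigenspaces of the diagonalizable part -/

section SpectralSubspace

variable {K V : Type*} [Field K] [AddCommGroup V] [Module K V]

/-- The span of the eigenvectors of `d` whose eigenvalue lies in `s`. -/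
def eigenspaceSup (d : End K V) (s : Set K) : Submodule K V :=
  ⨆ μ ∈ s, d.eigenspace μ

variable {f d : End K V}

theorem eigenspaceSup_mono (d : End K V) {s t : Set K} (h : s ⊆ t) :
    d.eigenspaceSup s ≤ d.eigenspaceSup t :=
  biSup_mono h

theorem apply_mem_eigenspaceSup (h : Commute d f) {s : Set K} {x : V}
    (hx : x ∈ d.eigenspaceSup s) : f x ∈ d.eigenspaceSup s := by
  have : d.eigenspaceSup s ≤ (d.eigenspaceSup s).comap f := by
    refine iSup₂_le fun μ hμ x hx => ?_
    exact (le_iSup₂_of_le μ hμ le_rfl : d.eigenspace μ ≤ _)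
      (mapsTo_genEigenspace_of_comm h μ 1 hx)
  exact this hx

/-- The eigenspace is invariant under `f - d`, and on it `f - μ` coincides with the nilpotent `f -
d`. -/
theorem eigenspace_le_maxGenEigenspace_of_isNilpotent_sub (h : Commute d f)
    (hn : IsNilpotent (f - d)) (μ : K) : d.eigenspace μ ≤ f.maxGenEigenspace μ := by
  intro x hx
  obtain ⟨k, hk⟩ := hn
  rw [mem_maxGenEigenspace]
  refine ⟨k, ?_⟩
  have key : ∀ j : ℕ, ((f - μ • 1) ^ j) x = ((f - d) ^ j) x := by
    intro j
    induction j with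
    | zero => rfl
    | succ j ih =>
      have hmem : ((f - d) ^ j) x ∈ d.eigenspace μ :=
        mapsTo_genEigenspace_of_comm ((h.sub_right (Commute.refl d)).pow_right j) μ 1 hx
      rw [pow_succ', pow_succ', Module.End.mul_apply, Module.End.mul_apply, ih]
      simp [mem_eigenspace_iff.1 hmem]
  rw [key, hk, LinearMap.zero_apply]

theorem hasEigenvalue_of_eigenspace_ne_bot (h : Commute d f)
    (hn : IsNilpotent (f - d)) {μ : K} (hμ : d.eigenspace μ ≠ ⊥) : f.HasEigenvalue μ := by
  obtain ⟨x, hx, hx0⟩ := (Submodule.ne_bot_iff _).1 hμ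
  exact hasEigenvalue_of_mem_maxGenEigenspace
    (eigenspace_le_maxGenEigenspace_of_isNilpotent_sub h hn μ hx) hx0

/-- This locates the spectrum of `f` on the subspace; it rests on the independence of generalized
eigenspaces. -/
theorem mem_of_hasEigenvector_of_mem_eigenspaceSup (h : Commute d f)
    (hn : IsNilpotent (f - d)) {s : Set K} {c : K} {y : V} (hy : f.HasEigenvector c y)
    (hys : y ∈ d.eigenspaceSup s) : c ∈ s := by
  by_contra hc
  have h1 := (f.independent_maxGenEigenspace).disjoint_biSup hc
  have h2 : d.eigenspaceSup s ≤ ⨆ μ ∈ s, f.maxGenEigenspace μ :=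
    iSup₂_mono fun μ _ => eigenspace_le_maxGenEigenspace_of_isNilpotent_sub h hn μ
  have h3 : y ∈ f.maxGenEigenspace c := by
    rw [mem_maxGenEigenspace]
    exact ⟨1, by simp [hy.apply_eq_smul]⟩
  exact hy.2 (Submodule.disjoint_def.1 h1 y h3 (h2 hys))

theorem isCompl_eigenspaceSup (hd : ⨆ μ, d.eigenspace μ = ⊤) {s t : Set K} (hst : Disjoint s t)
    (hun : ∀ μ, d.eigenspace μ ≠ ⊥ → μ ∈ s ∪ t) :
    IsCompl (d.eigenspaceSup s) (d.eigenspaceSup t) := by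
  constructor
  · exact d.eigenspaces_iSupIndep.disjoint_biSup_biSup hst
  · rw [codisjoint_iff, eq_top_iff, ← hd]
    refine iSup_le fun μ => ?_
    by_cases hμ : d.eigenspace μ = ⊥
    · simp [hμ]
    rcases hun μ hμ with h | h
    · exact le_sup_of_le_left (le_iSup₂_of_le μ h le_rfl)
    · exact le_sup_of_le_right (le_iSup₂_of_le μ h le_rfl)

end SpectralSubspace

end Module.End

/-! ### Limits of `n`-th roots -/

section Root

theorem tendsto_rpow_one_div_mul {l : Filter ℕ} (hl : l ≤ atTop) {C : ℝ} (hC : 0 < C) (ρ : ℝ) :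
    Tendsto (fun n : ℕ => C ^ (1 / (n : ℝ)) * ρ) l (𝓝 ρ) := by
  have h : Tendsto (fun n : ℕ => C ^ (1 / (n : ℝ))) atTop (𝓝 (C ^ (0 : ℝ))) :=
    (Real.continuousAt_const_rpow hC.ne').tendsto.comp tendsto_one_div_atTop_nhds_zero_nat
  simpa using (h.mono_left hl).mul_const ρ

theorem pow_mul_rpow_one_div {C ρ : ℝ} (hC : 0 ≤ C) (hρ : 0 ≤ ρ) {n : ℕ} (hn : n ≠ 0) :
    (C * ρ ^ n) ^ (1 / (n : ℝ)) = C ^ (1 / (n : ℝ)) * ρ := by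
  rw [Real.mul_rpow hC (pow_nonneg hρ n), one_div, Real.pow_rpow_inv_natCast hρ hn]

theorem tendsto_rpow_one_div_of_exp_bounds {u : ℕ → ℝ} {a : ℝ} (hu : ∀ n, 0 ≤ u n)
    (ha : 0 ≤ a) (hU : ∀ ρ, a < ρ → ∃ C, 0 < C ∧ ∀ n, u n ≤ C * ρ ^ n)
    (hL : ∀ ρ, 0 < ρ → ρ < a → ∃ C, 0 < C ∧ ∀ n, C * ρ ^ n ≤ u n) :
    Tendsto (fun n : ℕ => u n ^ (1 / (n : ℝ))) atTop (𝓝 a) := by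
  refine tendsto_order.2 ⟨fun b hb => ?_, fun b hb => ?_⟩
  · rcases lt_or_ge b 0 with hb0 | hb0
    · exact Eventually.of_forall fun n => hb0.trans_le (Real.rpow_nonneg (hu n) _)
    obtain ⟨ρ, hbρ, hρa⟩ := exists_between hb
    have hρ : 0 < ρ := hb0.trans_lt hbρ
    obtain ⟨C, hC, h⟩ := hL ρ hρ hρa
    filter_upwards [(tendsto_order.1 (tendsto_rpow_one_div_mul le_rfl hC ρ)).1 b hbρ,
      eventually_ne_atTop 0] with n hn hn0
    refine hn.trans_le ?_
    rw [← pow_mul_rpow_one_div hC.le hρ.le hn0]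
    exact Real.rpow_le_rpow (by positivity) (h n) (by positivity)
  · obtain ⟨ρ, haρ, hρb⟩ := exists_between hb
    have hρ : 0 < ρ := ha.trans_lt haρ
    obtain ⟨C, hC, h⟩ := hU ρ haρ
    filter_upwards [(tendsto_order.1 (tendsto_rpow_one_div_mul le_rfl hC ρ)).2 b hρb,
      eventually_ne_atTop 0] with n hn hn0
    refine lt_of_le_of_lt ?_ hn
    rw [← pow_mul_rpow_one_div hC.le hρ.le hn0]
    exact Real.rpow_le_rpow (hu n) (h n) (by positivity)

/-- Stated for a general filter below `atTop` so that it can be used along ultrafilters. -/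
theorem le_of_tendsto_of_eventually_pow_le {l : Filter ℕ} [l.NeBot] (hl : l ≤ atTop)
    {s : ℕ → ℝ} {t C ρ : ℝ} (hs : ∀ n, 0 ≤ s n) (hC : 0 < C) (hρ : 0 ≤ ρ)
    (h : ∀ᶠ n in l, s n ^ n ≤ C * ρ ^ n) (ht : Tendsto s l (𝓝 t)) : t ≤ ρ := by
  refine le_of_tendsto_of_tendsto ht (tendsto_rpow_one_div_mul hl hC ρ) ?_
  filter_upwards [h, hl (eventually_ne_atTop 0)] with n hn hn0
  rw [← pow_mul_rpow_one_div hC.le hρ hn0, ← Real.pow_rpow_inv_natCast (hs n) hn0, one_div]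
  exact Real.rpow_le_rpow (pow_nonneg (hs n) n) hn (by positivity)

theorem ge_of_tendsto_of_eventually_le_pow {l : Filter ℕ} [l.NeBot] (hl : l ≤ atTop)
    {s : ℕ → ℝ} {t C ρ : ℝ} (hs : ∀ n, 0 ≤ s n) (hC : 0 < C) (hρ : 0 ≤ ρ)
    (h : ∀ᶠ n in l, C * ρ ^ n ≤ s n ^ n) (ht : Tendsto s l (𝓝 t)) : ρ ≤ t := by
  refine le_of_tendsto_of_tendsto (tendsto_rpow_one_div_mul hl hC ρ) ht ?_
  filter_upwards [h, hl (eventually_ne_atTop 0)] with n hn hn0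
  rw [← pow_mul_rpow_one_div hC.le hρ hn0, ← Real.pow_rpow_inv_natCast (hs n) hn0, one_div]
  exact Real.rpow_le_rpow (by positivity) hn (by positivity)

end Root

/-! ### Lower growth bounds modulo a spectral subspace -/

namespace Module.End

/-- `P` is the projection along the `s`-part onto the `t`-part, in general oblique. It commutes with
`f`, so growth on the `t`-part, where eigenvalues have modulus at least `r`, bounds `f ^ n` below on
the whole space. -/
theorem exists_projection_le_norm_pow_apply {F : Type*} [NormedAddCommGroup F] [NormedSpace ℂ F]
    [FiniteDimensional ℂ F] {f d : End ℂ F} (h : Commute d f) (hn : IsNilpotent (f - d))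
    (hd : ⨆ μ, d.eigenspace μ = ⊤) {s t : Set ℂ} (hst : Disjoint s t)
    (hun : ∀ μ, d.eigenspace μ ≠ ⊥ → μ ∈ s ∪ t) {r : ℝ} (hr : 0 < r) (ht : ∀ μ ∈ t, r ≤ ‖μ‖) :
    ∃ P : End ℂ F, (∀ x, P x = 0 ↔ x ∈ d.eigenspaceSup s) ∧
      (∀ (p : ℕ) (x : F), (f ^ p) x ∈ d.eigenspaceSup s → x ∈ d.eigenspaceSup s) ∧
      ∀ ρ, 0 < ρ → ρ < r → ∃ C, 0 < C ∧ ∀ (n : ℕ) (x : F), C * ρ ^ n * ‖P x‖ ≤ ‖(f ^ n) x‖ := by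
  have hc := (isCompl_eigenspaceSup hd hst hun).symm
  set P : End ℂ F := (d.eigenspaceSup t).projection (d.eigenspaceSup s) hc with hP
  have hker : ∀ x, P x = 0 ↔ x ∈ d.eigenspaceSup s := fun x =>
    Submodule.projection_apply_eq_zero_iff hc
  have hmem : ∀ x, P x ∈ d.eigenspaceSup t := fun x => Submodule.projection_apply_mem hc x
  have hPt : ∀ x ∈ d.eigenspaceSup t, P x = x := fun x hx =>
    Submodule.projection_apply_of_mem_left hc hx
  have hcomm : ∀ (p : ℕ) x, P ((f ^ p) x) = (f ^ p) (P x) := by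
    intro p x
    have hsub : x - P x ∈ d.eigenspaceSup s := by
      rw [← hker, map_sub, hPt _ (hmem x), sub_self]
    have h1 := (hker _).2 (apply_mem_eigenspaceSup (h.pow_right p) hsub)
    rw [map_sub, map_sub, hPt _ (apply_mem_eigenspaceSup (h.pow_right p) (hmem x))] at h1
    exact sub_eq_zero.1 h1
  have hlow : ∀ ρ, 0 < ρ → ρ < r → ∃ C, 0 < C ∧ ∀ (n : ℕ), ∀ x ∈ d.eigenspaceSup t,
      C * ρ ^ n * ‖x‖ ≤ ‖(f ^ n) x‖ := fun ρ hρ hρr =>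
    exists_le_norm_pow_apply_of_invariant f (fun x hx => apply_mem_eigenspaceSup h hx) hρ
      fun c y hy hcy => hρr.trans_le (ht c (mem_of_hasEigenvector_of_mem_eigenspaceSup h hn hcy hy))
  refine ⟨P, hker, fun p x hx => ?_, fun ρ hρ hρr => ?_⟩
  -- Any rate in `(0, r)` would do: only injectivity of `f ^ p` on the `t`-part is needed.
  · obtain ⟨C, hC, hb⟩ := hlow (r / 2) (by positivity) (by linarith)
    rw [← hker, hcomm] at hx
    have h1 := hb p (P x) (hmem x)
    rw [hx, norm_zero] at h1
    rw [← hker, ← norm_le_zero_iff]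
    exact le_of_mul_le_mul_left (by simpa using h1) (show 0 < C * (r / 2) ^ p by positivity)
  · obtain ⟨C, hC, hb⟩ := hlow ρ hρ hρr
    obtain ⟨M, hM, hMb⟩ := (LinearMap.toContinuousLinearMap P).bound
    refine ⟨C / M, by positivity, fun n x => ?_⟩
    have h1 := hb n (P x) (hmem x)
    rw [← hcomm] at h1
    have h2 := h1.trans (hMb ((f ^ n) x))
    rw [div_mul_eq_mul_div, div_mul_eq_mul_div, div_le_iff₀ hM]
    linarith

end Module.End

/-! ### Growth rates along a flag -/

section GrowthFlag

variable {E : Type*} [NormedAddCommGroup E] [InnerProductSpace ℂ E]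

/-- A flag `V` along which the powers of `f` grow at the exponential rates `a`. -/
structure IsGrowthFlag {k : ℕ} (f : Module.End ℂ E) (V : Fin (k + 1) → Submodule ℂ E)
    (a : Fin k → ℝ) : Prop where
  mono : Monotone V
  strictMono : StrictMono a
  nonneg : ∀ j, 0 ≤ a j
  zero : V 0 = ⊥
  last : V (Fin.last k) = ⊤
  upper : ∀ j ρ, a j < ρ → ∃ C, 0 < C ∧ ∀ (n : ℕ), ∀ x ∈ V j.succ, ‖(f ^ n) x‖ ≤ C * ρ ^ n * ‖x‖
  lower : ∀ j, 0 < a j → ∃ P : Module.End ℂ E, (∀ x, P x = 0 ↔ x ∈ V j.castSucc) ∧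
    (∀ (p : ℕ) (x : E), (f ^ p) x ∈ V j.castSucc → x ∈ V j.castSucc) ∧
    ∀ ρ, 0 < ρ → ρ < a j → ∃ C, 0 < C ∧ ∀ (n : ℕ) (x : E), C * ρ ^ n * ‖P x‖ ≤ ‖(f ^ n) x‖
  map_mem : ∀ i, ∀ x ∈ V i, f x ∈ V i

namespace IsGrowthFlag

variable {k : ℕ} {f : Module.End ℂ E} {V : Fin (k + 1) → Submodule ℂ E} {a : Fin k → ℝ}

theorem tendsto_norm_rpow (h : IsGrowthFlag f V a) {j : Fin k} {x : E} (hx : x ∈ V j.succ)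
    (hx' : x ∉ V j.castSucc) :
    Tendsto (fun n : ℕ => ‖(f ^ n) x‖ ^ (1 / (n : ℝ))) atTop (𝓝 (a j)) := by
  have hx0 : 0 < ‖x‖ := norm_pos_iff.2 fun h0 => hx' (h0 ▸ zero_mem _)
  refine tendsto_rpow_one_div_of_exp_bounds (fun n => norm_nonneg _) (h.nonneg j)
    (fun ρ hρ => ?_) fun ρ hρ hρa => ?_
  · obtain ⟨C, hC, hb⟩ := h.upper j ρ hρ
    exact ⟨C * ‖x‖, by positivity, fun n => (hb n x hx).trans_eq (by ring)⟩
  · obtain ⟨P, hP, -, hL⟩ := h.lower j (hρ.trans hρa)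
    obtain ⟨C, hC, hb⟩ := hL ρ hρ hρa
    have hPx : 0 < ‖P x‖ := norm_pos_iff.2 fun h0 => hx' ((hP x).1 h0)
    exact ⟨C * ‖P x‖, by positivity, fun n => le_of_eq_of_le (by ring) (hb n x)⟩

theorem exists_mem_succ_notMem_castSucc (h : IsGrowthFlag f V a) {x : E} (hx : x ≠ 0) :
    ∃ j : Fin k, x ∈ V j.succ ∧ x ∉ V j.castSucc := by
  have hex : ∃ i, x ∈ V i := ⟨Fin.last k, by rw [h.last]; trivial⟩
  obtain ⟨i, hi, hmin⟩ := WellFounded.has_min (wellFounded_lt (α := Fin (k + 1))) _ hex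
  induction i using Fin.cases with
  | zero => 
    have h0 : x ∈ V 0 := hi
    rw [h.zero] at h0
    exact absurd ((Submodule.mem_bot ℂ).1 h0) hx
  | succ j => exact ⟨j, hi, fun hc => hmin _ hc Fin.castSucc_lt_succ⟩

/-- Every nonzero vector lies in some layer, and distinct layers have distinct rates. -/
theorem mem_sdiff_iff_tendsto (h : IsGrowthFlag f V a) {j : Fin k} {x : E} (hx : x ≠ 0) :
    (x ∈ V j.succ ∧ x ∉ V j.castSucc) ↔
      Tendsto (fun n : ℕ => ‖(f ^ n) x‖ ^ (1 / (n : ℝ))) atTop (𝓝 (a j)) := by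
  refine ⟨fun hj => h.tendsto_norm_rpow hj.1 hj.2, fun ht => ?_⟩
  obtain ⟨i, hi⟩ := h.exists_mem_succ_notMem_castSucc hx
  have := h.strictMono.injective (tendsto_nhds_unique (h.tendsto_norm_rpow hi.1 hi.2) ht)
  rwa [← this]

theorem pow_apply_mem (h : IsGrowthFlag f V a) {i : Fin (k + 1)} {x : E} (hx : x ∈ V i) (p : ℕ) :
    (f ^ p) x ∈ V i := by
  induction p with
  | zero => simpa using hx
  | succ p ih => rw [pow_succ', Module.End.mul_apply]; exact h.map_mem i _ ih

/-- Rates are nonnegative and strictly increasing, so rate `0` can occur only at the first index. -/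
theorem castSucc_eq_bot (h : IsGrowthFlag f V a) {j : Fin k} (hj : a j = 0) :
    V j.castSucc = ⊥ := by
  suffices hc : j.castSucc = 0 by rw [hc, h.zero]
  by_contra hne
  have hpos : 0 < (j : ℕ) := Nat.pos_of_ne_zero fun h0 => hne (Fin.ext (by simpa using h0))
  have := h.strictMono (show (⟨0, hpos.trans j.2⟩ : Fin k) < j from Fin.lt_def.2 hpos)
  linarith [h.nonneg ⟨0, hpos.trans j.2⟩]

end IsGrowthFlag

/-! ### The limit operator and limits of eigenvectors -/

variable [FiniteDimensional ℂ E]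

/-- The operator `∑ j, a j • (E_{j+1} - E_j)` for the orthogonal projections `E_i` onto the
members of a flag `V`. -/
noncomputable def flagOperator {k : ℕ} (V : Fin (k + 1) → Submodule ℂ E) (a : Fin k → ℝ) :
    E →L[ℂ] E :=
  ∑ j : Fin k, (a j : ℂ) • ((V j.succ).starProjection - (V j.castSucc).starProjection)

/-- In terms with `i < j` both projections kill `x`, in those with `i > j` both fix it, so only the
`j`-th term survives. -/
theorem flagOperator_apply_of_mem {k : ℕ} {V : Fin (k + 1) → Submodule ℂ E} (hV : Monotone V)
    (a : Fin k → ℝ) {j : Fin k} {x : E} (hx : x ∈ V j.succ)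
    (hx' : (V j.castSucc).starProjection x = 0) : flagOperator V a x = (a j : ℂ) • x := by
  rw [flagOperator, _root_.sum_apply, Finset.sum_eq_single j]
  · simp [hx', Submodule.starProjection_eq_self_iff.2 hx]
  · intro i _ hij
    rcases lt_or_gt_of_ne hij with h | h
    · have key : ∀ q ≤ j.castSucc, (V q).starProjection x = 0 := fun q hq =>
        (Submodule.starProjection_apply_eq_zero_iff _).2
          (Submodule.orthogonal_le (hV hq) ((Submodule.starProjection_apply_eq_zero_iff _).1 hx'))
      simp [key i.succ (by simpa [Fin.le_def] using h),
        key i.castSucc (Fin.castSucc_le_castSucc_iff.2 h.le)]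
    · have key : ∀ q ≥ j.succ, (V q).starProjection x = x := fun q hq =>
        Submodule.starProjection_eq_self_iff.2 (hV hq hx)
      simp [key i.succ (Fin.succ_le_succ_iff.2 h.le),
        key i.castSucc (by simpa [Fin.le_def] using h)]
  · simp

namespace IsGrowthFlag

variable {k : ℕ} {f : Module.End ℂ E} {V : Fin (k + 1) → Submodule ℂ E} {a : Fin k → ℝ}

theorem le_limit (h : IsGrowthFlag f V a) {l : Filter ℕ} [l.NeBot] (hl : l ≤ atTop) {e : ℕ → E}
    {s : ℕ → ℝ} {e₀ : E} {s₀ : ℝ} (hs : ∀ n, 0 ≤ s n)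
    (hse : ∀ᶠ n in l, s n ^ n = ‖(f ^ n) (e n)‖) (he : Tendsto e l (𝓝 e₀))
    (hs₀ : Tendsto s l (𝓝 s₀)) {j : Fin k} (hj : e₀ ∉ V j.castSucc) : a j ≤ s₀ := by
  rcases (h.nonneg j).eq_or_lt with h0 | h0
  · rw [← h0]
    exact ge_of_tendsto' hs₀ hs
  obtain ⟨P, hP, -, hL⟩ := h.lower j h0
  refine le_of_forall_lt fun b hb => ?_
  rcases lt_or_ge b 0 with hb0 | hb0
  · exact hb0.trans_le (ge_of_tendsto' hs₀ hs)
  obtain ⟨ρ, hbρ, hρa⟩ := exists_between hb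
  have hρ : 0 < ρ := hb0.trans_lt hbρ
  obtain ⟨C, hC, hCb⟩ := hL ρ hρ hρa
  have hPe : 0 < ‖P e₀‖ := norm_pos_iff.2 fun h0 => hj ((hP _).1 h0)
  have hPt : Tendsto (fun n => ‖P (e n)‖) l (𝓝 ‖P e₀‖) :=
    (((LinearMap.continuous_of_finiteDimensional P).tendsto _).comp he).norm
  -- The factor `‖P e₀‖ / 2` is a lower bound for `‖P (e n)‖` eventually, by continuity of `P`.
  refine hbρ.trans_le (ge_of_tendsto_of_eventually_le_pow hl hs
    (C := C * (‖P e₀‖ / 2)) (by positivity) hρ.le ?_ hs₀)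
  filter_upwards [hse, (tendsto_order.1 hPt).1 _ (half_lt_self hPe)] with n hn hn'
  rw [hn]
  refine le_trans ?_ (hCb n (e n))
  rw [mul_right_comm]
  gcongr

theorem limit_le (h : IsGrowthFlag f V a) {l : Filter ℕ} [l.NeBot] (hl : l ≤ atTop) {e : ℕ → E}
    {s : ℕ → ℝ} {e₀ : E} {s₀ : ℝ} (hs : ∀ n, 0 ≤ s n)
    (hse : ∀ᶠ n in l, ∀ v, s n ^ n * ‖inner ℂ (e n) v‖ ≤ ‖(f ^ n) v‖) (he : Tendsto e l (𝓝 e₀))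
    (hs₀ : Tendsto s l (𝓝 s₀)) {j : Fin k} (hj : (V j.succ).starProjection e₀ ≠ 0) :
    s₀ ≤ a j := by
  refine le_of_forall_gt fun ρ hρa => ?_
  obtain ⟨ρ, hρa', hρ'⟩ := exists_between hρa
  refine lt_of_le_of_lt ?_ hρ'
  have hρ : 0 < ρ := (h.nonneg j).trans_lt hρa'
  obtain ⟨C, hC, hCb⟩ := h.upper j ρ hρa'
  set v := (V j.succ).starProjection e₀ with hv
  have hvm : v ∈ V j.succ := Submodule.starProjection_apply_mem _ _
  have hv0 : 0 < ‖v‖ := norm_pos_iff.2 hj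
  have hin : ‖inner ℂ e₀ v‖ = ‖v‖ ^ 2 := by
    have h1 : inner ℂ e₀ v = inner ℂ v v := by
      have := Submodule.starProjection_inner_eq_zero (K := V j.succ) e₀ v hvm
      rwa [inner_sub_left, sub_eq_zero] at this
    rw [h1, inner_self_eq_norm_sq_to_K]
    simp
  have hit : Tendsto (fun n => ‖inner ℂ (e n) v‖) l (𝓝 (‖v‖ ^ 2)) := by
    rw [← hin]
    exact (he.inner tendsto_const_nhds).norm
  refine le_of_tendsto_of_eventually_pow_le hl hs (C := C * ‖v‖ / (‖v‖ ^ 2 / 2))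
    (by positivity) hρ.le ?_ hs₀
  filter_upwards [hse, (tendsto_order.1 hit).1 _ (half_lt_self (pow_pos hv0 2))] with n hn hn'
  rw [div_mul_eq_mul_div, le_div_iff₀ (by positivity)]
  calc s n ^ n * (‖v‖ ^ 2 / 2) ≤ s n ^ n * ‖inner ℂ (e n) v‖ :=
        mul_le_mul_of_nonneg_left hn'.le (pow_nonneg (hs n) n)
    _ ≤ ‖(f ^ n) v‖ := hn v
    _ ≤ C * ρ ^ n * ‖v‖ := hCb n v hvm
    _ = C * ‖v‖ * ρ ^ n := by ring

/-- With `j` the first layer onto which `e₀` projects nontrivially, the two bounds give `s₀ = a j`,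
and `e₀` is orthogonal to the preceding subspace. -/
theorem flagOperator_limit (h : IsGrowthFlag f V a) {l : Filter ℕ} [l.NeBot] (hl : l ≤ atTop)
    {e : ℕ → E} {s : ℕ → ℝ} {e₀ : E} {s₀ : ℝ} (hs : ∀ n, 0 ≤ s n)
    (hse : ∀ᶠ n in l, s n ^ n = ‖(f ^ n) (e n)‖)
    (hse' : ∀ᶠ n in l, ∀ v, s n ^ n * ‖inner ℂ (e n) v‖ ≤ ‖(f ^ n) v‖)
    (he : Tendsto e l (𝓝 e₀)) (hs₀ : Tendsto s l (𝓝 s₀)) :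
    flagOperator V a e₀ = (s₀ : ℂ) • e₀ := by
  classical
  by_cases he0 : e₀ = 0
  · simp [he0]
  have hex : ∃ i : Fin (k + 1), (V i).starProjection e₀ ≠ 0 :=
    ⟨Fin.last k, by
      rwa [Submodule.starProjection_eq_self_iff.2 (by rw [h.last]; trivial)]⟩
  obtain ⟨i, hi, hmin⟩ := WellFounded.has_min (wellFounded_lt (α := Fin (k + 1))) _ hex
  induction i using Fin.cases with
  | zero => exact absurd (by simp [h.zero]) hi
  | succ j =>
    have hcs : (V j.castSucc).starProjection e₀ = 0 := by
      by_contra hne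
      exact hmin _ hne Fin.castSucc_lt_succ
    have hnot : e₀ ∉ V j.castSucc := fun hm =>
      he0 ((Submodule.starProjection_eq_self_iff.2 hm).symm.trans hcs)
    have hsj : s₀ = a j := le_antisymm (h.limit_le hl hs hse' he hs₀ hi)
      (h.le_limit hl hs hse he hs₀ hnot)
    have hmem : e₀ ∈ V j.succ := by
      -- Otherwise `e₀` would escape the next layer's predecessor too, and `le_limit` would give a
      -- strictly larger rate as a lower bound for `s₀ = a j`.
      by_contra hm
      rcases Fin.eq_castSucc_or_eq_last j.succ with ⟨j', hj'⟩ | hlast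
      · rw [hj'] at hm
        have h1 := h.le_limit hl hs hse he hs₀ hm
        have h2 : j < j' := by
          have := congrArg Fin.val hj'
          simp only [Fin.val_succ, Fin.val_castSucc] at this
          exact Fin.lt_def.2 (by omega)
        exact absurd (h.strictMono h2) (by rw [← hsj]; exact h1.not_gt)
      · rw [hlast, h.last] at hm
        exact hm trivial
    rw [flagOperator_apply_of_mem h.mono a hmem hcs, hsj]

theorem tendsto_sum_eigenvectors (h : IsGrowthFlag f V a) {ι : Type*} [Fintype ι]
    (b : ℕ → OrthonormalBasis ι ℂ E) (s : ℕ → ι → ℝ) (hs : ∀ n i, 0 ≤ s n i)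
    (hse : ∀ n ≠ 0, ∀ i, s n i ^ n = ‖(f ^ n) (b n i)‖)
    (hse' : ∀ n ≠ 0, ∀ i v, s n i ^ n * ‖inner ℂ (b n i) v‖ ≤ ‖(f ^ n) v‖) (x : E) :
    Tendsto (fun n => ∑ i, (s n i : ℂ) • inner ℂ (b n i) x • b n i) atTop
      (𝓝 (flagOperator V a x)) := by
  -- Along an ultrafilter all bounded families converge at once, so no subsequences or consistent
  -- choice of eigenbases is needed.
  rw [tendsto_iff_ultrafilter]
  intro l hl
  have hne : ∀ᶠ n in (l : Filter ℕ), n ≠ 0 := hl (eventually_ne_atTop 0)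
  have : ProperSpace E := FiniteDimensional.proper ℂ E
  have hb : ∀ i, ∃ e₀, Tendsto (fun n => b n i) l (𝓝 e₀) := by
    intro i
    obtain ⟨e₀, -, he⟩ := (isCompact_sphere (0 : E) 1).ultrafilter_le_nhds'
      (l.map fun n => b n i)
      (Ultrafilter.mem_map.2 (Filter.mem_of_superset univ_mem fun n _ => by simp))
    exact ⟨e₀, he⟩
  have hs' : ∀ i, ∃ s₀, Tendsto (fun n => s n i) l (𝓝 s₀) := by
    intro i
    -- The bound `s n i ≤ ‖f‖` comes from `s n i ^ n = ‖(f ^ n) (b n i)‖ ≤ ‖f‖ ^ n`.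
    obtain ⟨s₀, -, hs₀⟩ := (isCompact_Icc (a := (0 : ℝ))
      (b := ‖LinearMap.toContinuousLinearMap f‖)).ultrafilter_le_nhds'
      (l.map fun n => s n i) (by
        rw [Ultrafilter.mem_map]
        change _ ∈ (l : Filter ℕ)
        filter_upwards [hne] with n hn
        refine ⟨hs n i, le_of_pow_le_pow_left₀ hn (norm_nonneg _) ?_⟩
        have hpow : ∀ (m : ℕ) (y : E),
            ‖(f ^ m) y‖ ≤ ‖LinearMap.toContinuousLinearMap f‖ ^ m * ‖y‖ := by
          intro m
          induction m with
          | zero => simp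
          | succ m ih =>
            intro y
            rw [pow_succ, Module.End.mul_apply, pow_succ, mul_assoc]
            exact (ih _).trans (mul_le_mul_of_nonneg_left
              ((LinearMap.toContinuousLinearMap f).le_opNorm y) (by positivity))
        rw [hse n hn i]
        simpa using hpow n (b n i))
    exact ⟨s₀, hs₀⟩
  choose e₀ he₀ using hb
  choose s₀ hs₀ using hs'
  have heig : ∀ i, flagOperator V a (e₀ i) = (s₀ i : ℂ) • e₀ i := fun i =>
    h.flagOperator_limit hl (fun n => hs n i) (hne.mono fun n hn => hse n hn i)
      (hne.mono fun n hn => hse' n hn i) (he₀ i) (hs₀ i)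
  have hinner : ∀ i, Tendsto (fun n => inner ℂ (b n i) x • b n i) l
      (𝓝 (inner ℂ (e₀ i) x • e₀ i)) := fun i =>
    ((he₀ i).inner tendsto_const_nhds).smul (he₀ i)
  -- The orthonormal expansion of `x` survives the limit, so the `e₀ i` still span.
  have hx : x = ∑ i, inner ℂ (e₀ i) x • e₀ i := by
    refine tendsto_nhds_unique ?_ (tendsto_finsetSum Finset.univ fun i _ => hinner i)
    simp only [OrthonormalBasis.sum_repr', tendsto_const_nhds]
  have hlim : flagOperator V a x = ∑ i, (s₀ i : ℂ) • inner ℂ (e₀ i) x • e₀ i := by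
    conv_lhs => rw [hx]
    rw [map_sum]
    refine Finset.sum_congr rfl fun i _ => ?_
    rw [map_smul, heig, smul_comm]
  rw [hlim]
  exact tendsto_finsetSum _ fun i _ =>
    ((Complex.continuous_ofReal.tendsto _).comp (hs₀ i)).smul (hinner i)

end IsGrowthFlag

end GrowthFlag

/-! ### Matrices: the modulus flag, absolute values and their roots -/

section MatrixFacts

variable {m : ℕ}

theorem toEuclideanLin_orthProjMatrix (U : Submodule ℂ (EuclideanSpace ℂ (Fin m)))
    (x : EuclideanSpace ℂ (Fin m)) :
    Matrix.toEuclideanLin (orthProjMatrix U) x = U.starProjection x := by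
  rw [← Matrix.coe_toEuclideanCLM_eq_toEuclideanLin, orthProjMatrix, StarAlgEquiv.apply_symm_apply]
  rfl

theorem matrixRan_orthProjMatrix (U : Submodule ℂ (EuclideanSpace ℂ (Fin m))) :
    matrixRan (orthProjMatrix U) = U := by
  ext x
  rw [matrixRan, LinearMap.mem_range]
  constructor
  · rintro ⟨y, rfl⟩
    rw [toEuclideanLin_orthProjMatrix]
    exact Submodule.starProjection_apply_mem _ _
  · intro hx
    exact ⟨x, by rw [toEuclideanLin_orthProjMatrix, Submodule.starProjection_eq_self_iff.2 hx]⟩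

theorem eigenvectorSpan_eq_eigenspaceSup (D : Matrix (Fin m) (Fin m) ℂ) (r : ℝ) :
    eigenvectorSpan D r =
      Module.End.eigenspaceSup (Matrix.toEuclideanLin D) {μ : ℂ | ‖μ‖ ≤ r} := by
  apply le_antisymm
  · refine Submodule.span_le.2 ?_
    rintro x ⟨μ, hμ, hx⟩
    exact (le_iSup₂_of_le μ hμ le_rfl :
      Module.End.eigenspace (Matrix.toEuclideanLin D) μ ≤ _) hx.1
  · refine iSup₂_le fun μ hμ x hx => ?_
    by_cases hx0 : x = 0
    · rw [hx0]; exact zero_mem _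
    · exact Submodule.subset_span ⟨μ, hμ, hx, hx0⟩

/-- The subspaces `ran E_0 ≤ ran E_1 ≤ ⋯ ≤ ran E_k`. -/
noncomputable def modulusFlag {k : ℕ} (D : Matrix (Fin m) (Fin m) ℂ) (a : Fin k → ℝ)
    (i : Fin (k + 1)) : Submodule ℂ (EuclideanSpace ℂ (Fin m)) :=
  Module.End.eigenspaceSup (Matrix.toEuclideanLin D) {μ : ℂ | ∃ j, j.castSucc < i ∧ ‖μ‖ ≤ a j}

/-- The flag is described through indices below `i` so that `i = 0` yields the empty set; at a
successor the description collapses to a single modulus bound. -/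
theorem setOf_modulus_succ {k : ℕ} {a : Fin k → ℝ} (ha : StrictMono a) (j : Fin k) :
    {μ : ℂ | ∃ i : Fin k, i.castSucc < j.succ ∧ ‖μ‖ ≤ a i} = {μ : ℂ | ‖μ‖ ≤ a j} := by
  ext μ
  constructor
  · rintro ⟨i, hi, hμ⟩
    exact hμ.trans (ha.monotone (Fin.castSucc_lt_succ_iff.1 hi))
  · exact fun hμ => ⟨j, Fin.castSucc_lt_succ, hμ⟩

theorem modulusFlag_zero {k : ℕ} (D : Matrix (Fin m) (Fin m) ℂ) (a : Fin k → ℝ) :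
    modulusFlag D a 0 = ⊥ := by
  simp [modulusFlag, Module.End.eigenspaceSup]

theorem modulusProj_eq {k : ℕ} (D : Matrix (Fin m) (Fin m) ℂ) {a : Fin k → ℝ} (ha : StrictMono a)
    (i : Fin (k + 1)) : modulusProj D a i = orthProjMatrix (modulusFlag D a i) := by
  induction i using Fin.cases with
  | zero => simp [modulusProj, modulusFlag_zero, orthProjMatrix]
  | succ j =>
    rw [modulusProj, Fin.cons_succ, eigenvectorSpan_eq_eigenspaceSup, modulusFlag,
      setOf_modulus_succ ha]

theorem mem_ranDiff_iff {k : ℕ} (D : Matrix (Fin m) (Fin m) ℂ) {a : Fin k → ℝ}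
    (ha : StrictMono a) (j : Fin k) (x : EuclideanSpace ℂ (Fin m)) :
    x ∈ ranDiff D a j ↔ x ∈ modulusFlag D a j.succ ∧ x ∉ modulusFlag D a j.castSucc := by
  simp only [ranDiff, modulusProj_eq D ha, matrixRan_orthProjMatrix]
  rfl

theorem toEuclideanLin_sum_modulusProj {k : ℕ} (D : Matrix (Fin m) (Fin m) ℂ) {a : Fin k → ℝ}
    (ha : StrictMono a) (x : EuclideanSpace ℂ (Fin m)) :
    Matrix.toEuclideanLin
        (∑ j : Fin k, (a j : ℂ) • (modulusProj D a j.succ - modulusProj D a j.castSucc)) x =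
      flagOperator (modulusFlag D a) a x := by
  simp only [modulusProj_eq D ha, map_sum, map_smul, map_sub, LinearMap.sum_apply,
    LinearMap.smul_apply, LinearMap.sub_apply, toEuclideanLin_orthProjMatrix, flagOperator,
    _root_.sum_apply, _root_.smul_apply, _root_.sub_apply]

theorem IsJordanChevalley.isGrowthFlag {k : ℕ} {A D N : Matrix (Fin m) (Fin m) ℂ}
    (hA : IsJordanChevalley A D N) {a : Fin k → ℝ} (ha : StrictMono a)
    (ha' : Set.range a = eigenvalueModuli A) :
    IsGrowthFlag (Matrix.toEuclideanLin A) (modulusFlag D a) a := by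
  set f : Module.End ℂ (EuclideanSpace ℂ (Fin m)) := Matrix.toEuclideanLin A with hf
  set d : Module.End ℂ (EuclideanSpace ℂ (Fin m)) := Matrix.toEuclideanLin D with hd
  have hcomm : Commute d f := by
    have h1 : Commute D A := hA.add_eq ▸ (Commute.refl D).add_right hA.commute
    exact h1.map (Matrix.toLpLinAlgEquiv 2 : Matrix (Fin m) (Fin m) ℂ ≃ₐ[ℂ] _)
  have hnil : IsNilpotent (f - d) := by
    have h1 : f - d = Matrix.toEuclideanLin N := by
      rw [hf, hd, ← map_sub, hA.add_eq, add_sub_cancel_left]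
    rw [h1]
    exact hA.nilpotent.map (Matrix.toLpLinAlgEquiv 2 : Matrix (Fin m) (Fin m) ℂ ≃ₐ[ℂ] _)
  have htop : ⨆ μ, d.eigenspace μ = ⊤ := hA.diagonalizable
  have hmod : ∀ μ, d.eigenspace μ ≠ ⊥ → ∃ j, a j = ‖μ‖ := by
    intro μ hμ
    have : ‖μ‖ ∈ Set.range a := by
      rw [ha']
      exact ⟨μ, Module.End.hasEigenvalue_of_eigenspace_ne_bot hcomm hnil hμ, rfl⟩
    exact this
  have hnonneg : ∀ j, 0 ≤ a j := by
    intro j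
    obtain ⟨μ, -, hμ⟩ : a j ∈ eigenvalueModuli A := ha' ▸ Set.mem_range_self j
    exact hμ ▸ norm_nonneg μ
  refine
    { mono := fun i i' hii' => Module.End.eigenspaceSup_mono d ?_
      strictMono := ha
      nonneg := hnonneg
      zero := modulusFlag_zero D a
      last := ?_
      upper := fun j ρ hρ => ?_
      lower := fun j hj => ?_
      map_mem := fun i x hx => Module.End.apply_mem_eigenspaceSup hcomm hx }
  · rintro μ ⟨j, hj, hμ⟩
    exact ⟨j, hj.trans_le hii', hμ⟩
  · rw [eq_top_iff, ← htop]
    refine iSup_le fun μ => ?_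
    by_cases hμ : d.eigenspace μ = ⊥
    · rw [hμ]; exact bot_le
    · obtain ⟨j, hj⟩ := hmod μ hμ
      exact le_iSup₂_of_le (f := fun μ (_ : μ ∈ _) => d.eigenspace μ) μ
        ⟨j, Fin.castSucc_lt_last j, hj.ge⟩ le_rfl
  · refine Module.End.exists_norm_pow_apply_le_of_invariant f
      (fun x hx => Module.End.apply_mem_eigenspaceSup hcomm hx) ((hnonneg j).trans_lt hρ)
      fun c y hy hcy => lt_of_le_of_lt ?_ hρ
    have := Module.End.mem_of_hasEigenvector_of_mem_eigenspaceSup hcomm hnil hcy hy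
    rwa [setOf_modulus_succ ha] at this
  · refine Module.End.exists_projection_le_norm_pow_apply hcomm hnil htop
      (t := {μ : ℂ | a j ≤ ‖μ‖}) ?_ ?_ hj fun μ hμ => hμ
    · rw [Set.disjoint_left]
      rintro μ ⟨i, hi, hμ⟩ (hμ' : a j ≤ ‖μ‖)
      exact absurd (ha (Fin.castSucc_lt_castSucc_iff.1 hi)) (hμ'.trans hμ).not_gt
    · intro μ hμ
      obtain ⟨i, hi⟩ := hmod μ hμ
      rcases lt_or_ge i j with h | h
      · exact Or.inl ⟨i, Fin.castSucc_lt_castSucc_iff.2 h, hi.ge⟩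
      · exact Or.inr ((ha.monotone h).trans hi.le)

theorem inner_toEuclideanLin_left (B : Matrix (Fin m) (Fin m) ℂ)
    (x y : EuclideanSpace ℂ (Fin m)) :
    inner ℂ (Matrix.toEuclideanLin B x) y =
      inner ℂ x (Matrix.toEuclideanLin B.conjTranspose y) := by
  rw [Matrix.toEuclideanLin_conjTranspose_eq_adjoint, LinearMap.adjoint_inner_right]

/-- Both squared norms are the quadratic form of `Bᴴ * B`. -/
theorem norm_toEuclideanLin_abs (B : Matrix (Fin m) (Fin m) ℂ) (x : EuclideanSpace ℂ (Fin m)) :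
    ‖Matrix.toEuclideanLin (CFC.abs B) x‖ = ‖Matrix.toEuclideanLin B x‖ := by
  have hs : (CFC.abs B).conjTranspose = CFC.abs B :=
    (Matrix.nonneg_iff_posSemidef.1 (CFC.abs_nonneg B)).isHermitian
  have key : ∀ T : Matrix (Fin m) (Fin m) ℂ, inner ℂ (Matrix.toEuclideanLin T x)
      (Matrix.toEuclideanLin T x) =
        inner ℂ x (Matrix.toEuclideanLin (T.conjTranspose * T) x) := by
    intro T
    rw [inner_toEuclideanLin_left, Matrix.toLpLin_mul_same, LinearMap.comp_apply]
  have h := (key (CFC.abs B)).trans (Eq.trans (by rw [hs, CFC.abs_mul_abs]; rfl) (key B).symm)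
  rw [inner_self_eq_norm_sq_to_K, inner_self_eq_norm_sq_to_K] at h
  exact (sq_eq_sq₀ (norm_nonneg _) (norm_nonneg _)).1 (by exact_mod_cast h)

theorem absRoot_posSemidef (T : Matrix (Fin m) (Fin m) ℂ) (n : ℕ) : (absRoot T n).PosSemidef :=
  Matrix.nonneg_iff_posSemidef.1 CFC.rpow_nonneg

theorem absRoot_pow (T : Matrix (Fin m) (Fin m) ℂ) {n : ℕ} (hn : n ≠ 0) :
    absRoot T n ^ n = CFC.abs T := by
  have h0 : 0 ≤ CFC.abs T := CFC.abs_nonneg T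
  have h1 : 0 ≤ absRoot T n := CFC.rpow_nonneg
  rw [← CFC.rpow_natCast _ n h1, absRoot,
    CFC.rpow_rpow_of_exponent_nonneg _ _ _ (by positivity) (by positivity) h0,
    one_div_mul_cancel (Nat.cast_ne_zero.2 hn), CFC.rpow_one _ h0]

theorem toEuclideanLin_eigenvectorBasis {S : Matrix (Fin m) (Fin m) ℂ} (hS : S.IsHermitian)
    (i : Fin m) : Matrix.toEuclideanLin S (hS.eigenvectorBasis i) =
      (hS.eigenvalues i : ℂ) • hS.eigenvectorBasis i := by
  rw [Matrix.toLpLin_apply, hS.mulVec_eigenvectorBasis]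
  rfl

theorem toEuclideanLin_pow_eigenvectorBasis {S : Matrix (Fin m) (Fin m) ℂ} (hS : S.IsHermitian)
    (i : Fin m) (n : ℕ) : Matrix.toEuclideanLin (S ^ n) (hS.eigenvectorBasis i) =
      ((hS.eigenvalues i ^ n : ℝ) : ℂ) • hS.eigenvectorBasis i := by
  induction n with
  | zero => simp
  | succ n ih =>
    rw [pow_succ, Matrix.toLpLin_mul_same, LinearMap.comp_apply, toEuclideanLin_eigenvectorBasis,
      map_smul, ih, smul_smul]
    push_cast
    ring_nf

theorem toEuclideanLin_eq_sum_eigenvectorBasis {S : Matrix (Fin m) (Fin m) ℂ}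
    (hS : S.IsHermitian) (x : EuclideanSpace ℂ (Fin m)) :
    Matrix.toEuclideanLin S x = ∑ i, (hS.eigenvalues i : ℂ) •
      inner ℂ (hS.eigenvectorBasis i) x • hS.eigenvectorBasis i := by
  conv_lhs => rw [← hS.eigenvectorBasis.sum_repr' x]
  rw [map_sum]
  refine Finset.sum_congr rfl fun i _ => ?_
  rw [map_smul, toEuclideanLin_eigenvectorBasis, smul_comm]

theorem Matrix.tendsto_of_tendsto_toEuclideanLin {S : ℕ → Matrix (Fin m) (Fin m) ℂ}
    {S₀ : Matrix (Fin m) (Fin m) ℂ} {l : Filter ℕ}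
    (h : ∀ x, Tendsto (fun n => Matrix.toEuclideanLin (S n) x) l
      (𝓝 (Matrix.toEuclideanLin S₀ x))) : Tendsto S l (𝓝 S₀) := by
  refine tendsto_pi_nhds.2 fun p => tendsto_pi_nhds.2 fun q => ?_
  have h1 := ((EuclideanSpace.proj (𝕜 := ℂ) p).continuous.tendsto _).comp
    (h (EuclideanSpace.single q 1))
  have h2 : ∀ T : Matrix (Fin m) (Fin m) ℂ,
      EuclideanSpace.proj (𝕜 := ℂ) p (Matrix.toEuclideanLin T (EuclideanSpace.single q 1)) =
        T p q := by
    intro T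
    simp [Matrix.toLpLin_apply]
  rw [h2] at h1
  exact h1.congr fun n => h2 (S n)

theorem Matrix.PosSemidef.of_tendsto {S : ℕ → Matrix (Fin m) (Fin m) ℂ}
    {S₀ : Matrix (Fin m) (Fin m) ℂ} (hS : ∀ n, (S n).PosSemidef)
    (h : Tendsto S atTop (𝓝 S₀)) : S₀.PosSemidef := by
  refine Matrix.PosSemidef.of_dotProduct_mulVec_nonneg ?_ fun x => ?_
  · refine tendsto_nhds_unique
      (((Continuous.matrix_conjTranspose continuous_id).tendsto S₀).comp h) ?_
    exact h.congr fun n => ((hS n).isHermitian).symm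
  · have hc : Continuous fun T : Matrix (Fin m) (Fin m) ℂ => star x ⬝ᵥ T.mulVec x :=
      Continuous.dotProduct continuous_const (Continuous.matrix_mulVec continuous_id continuous_const)
    exact ge_of_tendsto' ((hc.tendsto S₀).comp h) fun n => (hS n).dotProduct_mulVec_nonneg x

theorem IsGrowthFlag.tendsto_absRoot {k : ℕ} {A : Matrix (Fin m) (Fin m) ℂ}
    {V : Fin (k + 1) → Submodule ℂ (EuclideanSpace ℂ (Fin m))} {a : Fin k → ℝ}
    (h : IsGrowthFlag (Matrix.toEuclideanLin A) V a) (x : EuclideanSpace ℂ (Fin m)) :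
    Tendsto (fun n : ℕ => Matrix.toEuclideanLin (absRoot (A ^ n) n) x) atTop
      (𝓝 (flagOperator V a x)) := by
  have hS := fun n : ℕ => absRoot_posSemidef (A ^ n) n
  have habs : ∀ n ≠ 0, ∀ i, Matrix.toEuclideanLin (CFC.abs (A ^ n))
      ((hS n).isHermitian.eigenvectorBasis i) =
        (((hS n).isHermitian.eigenvalues i ^ n : ℝ) : ℂ) •
          (hS n).isHermitian.eigenvectorBasis i := by
    intro n hn i
    rw [← absRoot_pow (A ^ n) hn, toEuclideanLin_pow_eigenvectorBasis]
  have hpow : ∀ n i, 0 ≤ (hS n).isHermitian.eigenvalues i ^ n := fun n i =>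
    pow_nonneg ((hS n).eigenvalues_nonneg i) n
  refine (h.tendsto_sum_eigenvectors (fun n => (hS n).isHermitian.eigenvectorBasis)
    (fun n => (hS n).isHermitian.eigenvalues) (fun n => (hS n).eigenvalues_nonneg)
    (fun n hn i => ?_) (fun n hn i v => ?_) x).congr fun n =>
      (toEuclideanLin_eq_sum_eigenvectorBasis (hS n).isHermitian x).symm
  · rw [← Matrix.toLpLin_pow, ← norm_toEuclideanLin_abs, habs n hn, norm_smul, Complex.norm_real,
      Real.norm_of_nonneg (hpow n i), OrthonormalBasis.norm_eq_one, mul_one]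
  · have hsa : (CFC.abs (A ^ n)).conjTranspose = CFC.abs (A ^ n) :=
      (Matrix.nonneg_iff_posSemidef.1 (CFC.abs_nonneg (A ^ n))).isHermitian
    -- Moving the self-adjoint `|A^n|` across the inner product leaves a quantity that
    -- Cauchy–Schwarz bounds by `‖A^n v‖`.
    have h1 : (hS n).isHermitian.eigenvalues i ^ n *
        ‖inner ℂ ((hS n).isHermitian.eigenvectorBasis i) v‖ =
        ‖inner ℂ ((hS n).isHermitian.eigenvectorBasis i)
          (Matrix.toEuclideanLin (CFC.abs (A ^ n)) v)‖ := by
      conv_rhs => rw [← hsa]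
      rw [← inner_toEuclideanLin_left, habs n hn, inner_smul_left, norm_mul, RCLike.norm_conj,
        Complex.norm_real, Real.norm_of_nonneg (hpow n i)]
    rw [h1, ← Matrix.toLpLin_pow, ← norm_toEuclideanLin_abs]
    refine (norm_inner_le_norm _ _).trans_eq ?_
    rw [OrthonormalBasis.norm_eq_one, one_mul]

end MatrixFacts

/-! ### The main theorem -/

theorem theorem3p6 {m k : ℕ} (A D N : Matrix (Fin m) (Fin m) ℂ)
    (hA : IsJordanChevalley A D N)
    (a : Fin k → ℝ) (ha : StrictMono a) (ha' : Set.range a = eigenvalueModuli A) :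
    -- (i) convergence of `|A^n|^{1/n}` to a positive-semidefinite matrix
    ((∑ j : Fin k, (a j : ℂ) • (modulusProj D a j.succ - modulusProj D a j.castSucc)).PosSemidef ∧
      Tendsto (fun n : ℕ => absRoot (A ^ n) n) atTop
        (𝓝 (∑ j : Fin k, (a j : ℂ) • (modulusProj D a j.succ - modulusProj D a j.castSucc)))) ∧
    -- (ii) the growth rate of `‖A^n x‖`
    (∀ (j : Fin k) (x : EuclideanSpace ℂ (Fin m)), x ≠ 0 →
      (x ∈ ranDiff D a j ↔
        Tendsto (fun n : ℕ => ‖Matrix.toEuclideanLin (A ^ n) x‖ ^ (1 / (n : ℝ))) atTop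
          (𝓝 (a j)))) ∧
    -- (iii) invariance under the powers of `A`, the image being possibly `0` only if `a_j = 0`
    (∀ (j : Fin k) (p : ℕ),
      (a j ≠ 0 → Set.MapsTo (Matrix.toEuclideanLin (A ^ p)) (ranDiff D a j) (ranDiff D a j)) ∧
      (∀ x ∈ ranDiff D a j, Matrix.toEuclideanLin (A ^ p) x ≠ 0 →
        Matrix.toEuclideanLin (A ^ p) x ∈ ranDiff D a j)) := by
  have h := hA.isGrowthFlag ha ha'
  have hlim : Tendsto (fun n : ℕ => absRoot (A ^ n) n) atTop
      (𝓝 (∑ j : Fin k, (a j : ℂ) • (modulusProj D a j.succ - modulusProj D a j.castSucc))) := by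
    refine Matrix.tendsto_of_tendsto_toEuclideanLin fun x => ?_
    rw [toEuclideanLin_sum_modulusProj D ha]
    exact h.tendsto_absRoot x
  have hmaps : ∀ (j : Fin k) (p : ℕ), a j ≠ 0 →
      Set.MapsTo (Matrix.toEuclideanLin (A ^ p)) (ranDiff D a j) (ranDiff D a j) := by
    intro j p hj x hx
    rw [mem_ranDiff_iff D ha] at hx ⊢
    obtain ⟨P, -, hP, -⟩ := h.lower j (lt_of_le_of_ne (h.nonneg j) hj.symm)
    rw [Matrix.toLpLin_pow]
    exact ⟨h.pow_apply_mem hx.1 p, fun hc => hx.2 (hP p x hc)⟩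
  refine ⟨⟨Matrix.PosSemidef.of_tendsto (fun n => absRoot_posSemidef (A ^ n) n) hlim, hlim⟩,
    fun j x hx => ?_, fun j p => ⟨hmaps j p, fun x hx hpx => ?_⟩⟩
  · rw [mem_ranDiff_iff D ha, h.mem_sdiff_iff_tendsto hx]
    simp only [Matrix.toLpLin_pow]
  · by_cases hj : a j = 0
    -- Here the smaller subspace is `⊥`, so avoiding it means exactly being nonzero.
    · rw [mem_ranDiff_iff D ha, h.castSucc_eq_bot hj] at hx ⊢
      refine ⟨?_, hpx⟩
      rw [Matrix.toLpLin_pow]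
      exact h.pow_apply_mem hx.1 p
    · exact hmaps j p hj hx
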